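/- Let $0<W<\frac12$ and let $N\ge 1$ be an integer. The discrete prolate spheroidal sequences (DPSS's) $s^{(0)}_{N,W},\dots,s^{(N-1)}_{N,W}$ are real sequences indexed by $\mathbb Z$ which, with eigenvalues $1>\lambda^{(0)}_{N,W}>\dots>\lambda^{(N-1)}_{N,W}>0$, satisfy $\mathcal B_W\mathcal T_N s^{(\ell)}_{N,W}=\lambda^{(\ell)}_{N,W}s^{(\ell)}_{N,W}$ and $\|\mathcal T_N s^{(\ell)}_{N,W}\|_2=1$. Here $\mathcal T_N$ sets all entries outside $\{0,\dots,N-1\}$ to zero, and $\mathcal B_W$ restricts the discrete-time Fourier transform $X(f)=\sum_n x[n]e^{-\mathrm{j}2\pi fn}$ to $|f|\le W$, i.e. (with $\mathrm{j}=\sqrt{-1}$) $(\mathcal B_Wx)[n]=\int_{-W}^{W}X(f)e^{\mathrm{j}2\pi fn}\,df$. Let $S_{N,W}$ be the $N\times N$ matrix with entries $S_{N,W}[n,\ell]=s^{(\ell)}_{N,W}[n]$, $0\le n,\ell\le N-1$. For $0<\epsilon<1$, call constants $C_1,C_2>0$ and an integer $N_0\ge0$ admissible for $(W,\epsilon)$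 if $$\lambda^{(\ell)}_{N,W}\ge 1-C_1e^{-C_2N}\quad\text{for all } N\ge N_0 \text{ and all } \ell\in\{0,\dots,N-1\}\text{ with }\ell\le 2NW(1-\epsilon).$$ Let $B_{\mathrm{nyq}},B_{\mathrm{band}}>0$ be such that $J=B_{\mathrm{nyq}}/B_{\mathrm{band}}$ is an integer, let $0<T_s\le 1/B_{\mathrm{nyq}}$ with $W=B_{\mathrm{band}}T_s/2$, and put $f_i=\left(-\frac{B_{\mathrm{nyq}}}2+(i+\frac12)B_{\mathrm{band}}\right)T_s$ for $0\le i\le J-1$. For an integer $0\le k\le N$, the multiband modulated DPSS dictionary is the $N\times kJ$ matrix $\Psi=[\Psi_0\ \Psi_1\ \cdots\ \Psi_{J-1}]$, where $\Psi_i$ consists of the first $k$ columns of $E_{f_i}S_{N,W}$ and $E_f$ is the diagonal matrix with entries $e^{\mathrm{j}2\pi f n}$, $0\le n\le N-1$. Then the following holds. 1. There is an absolute constant $C_1>0$ such that for all $0<W<\frac12$ and $0<\epsilon<1$ there are $C_2>0$ and $N_0$, depending only on $W$ and $\epsilon$, such that $C_1,C_2,N_0$ are admissible for $(W,\epsilon)$.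 2. Let $0<W<\frac12$, $0<\epsilon<1$, and let $C_1,C_2,N_0$ be any constants admissible for $(W,\epsilon)$. Then for all $B_{\mathrm{nyq}},B_{\mathrm{band}},T_s,J$ as above with $W=B_{\mathrm{band}}T_s/2$, all $N\ge \max(1,N_0)$, and every integer $k\geq 0$ with $k\le 2NW(1-\epsilon)$ (in particular $k=2NW(1-\epsilon)$ when this is an integer), one has $D:=kJ<N$, and any two distinct columns $q_1,q_2$ of $\Psi$ satisfy $$|\langle q_1,q_2\rangle|\le 3\,C_1^{1/2}e^{-C_2N/2}.$$ -/

import Mathlib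

namespace MultibandDPSS

noncomputable section

/-- Discrete-time Fourier transform `X(f) = ∑ₙ x[n] e^{-j2πfn}` of a summable sequence.
It is only ever applied to finitely supported (time-limited) sequences. -/
def dtft (x : ℤ → ℂ) (f : ℝ) : ℂ :=
  ∑' n : ℤ, x n * Complex.exp (-(2 * Real.pi * f * n : ℝ) * Complex.I)

/-- Bandlimiting operator: restrict the DTFT to the digital frequencies `|f| ≤ W` and return
to the time domain by the inverse DTFT. -/
def bandLimit (W : ℝ) (x : ℤ → ℂ) (n : ℤ) : ℂ :=
  ∫ f in (-W)..W, dtft x f * Complex.exp ((2 * Real.pi * f * n : ℝ) * Complex.I)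

/-- Time-limiting operator: zero out all entries outside the index range `{0, …, N-1}`. -/
def timeLimit {R : Type*} [Zero R] (N : ℕ) (x : ℤ → R) (n : ℤ) : R :=
  if 0 ≤ n ∧ n < (N : ℤ) then x n else 0

/-- `s 0, …, s (N-1)` are the discrete prolate spheroidal sequences with parameters `N` and `W`,
and `lam 0, …, lam (N-1)` are the corresponding eigenvalues. (Such sequences exist for all `N`
and all `0 < W < 1/2`; the eigenvalues are unique, the sequences unique up to sign.) -/
structure IsDPSS (N : ℕ) (W : ℝ) (s : Fin N → ℤ → ℝ) (lam : Fin N → ℝ) : Prop where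
  eigen : ∀ (l : Fin N) (n : ℤ),
    bandLimit W (timeLimit N (fun m => (s l m : ℂ))) n = (lam l : ℂ) * (s l n : ℂ)
  lam_lt_one : ∀ l, lam l < 1
  lam_pos : ∀ l, 0 < lam l
  lam_strictAnti : StrictAnti lam
  normalized : ∀ l, ∑' n : ℤ, (timeLimit N (s l) n) ^ 2 = 1

/-- The positive constants `C₁`, `C₂` and the integer `N₀` quantify the clustering near one of the
DPSS eigenvalues for the parameters `W` and `ε`:
`λ^{(l)} ≥ 1 - C₁ e^{-C₂ N}` for all `l ≤ 2NW(1-ε)` and all `N ≥ N₀`. -/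
def ClusterNearOne (W ε C₁ C₂ : ℝ) (N₀ : ℕ) : Prop :=
  0 < C₁ ∧ 0 < C₂ ∧
    ∀ N : ℕ, N₀ ≤ N → ∀ (s : Fin N → ℤ → ℝ) (lam : Fin N → ℝ), IsDPSS N W s lam →
      ∀ l : Fin N, ((l : ℕ) : ℝ) ≤ 2 * N * W * (1 - ε) →
        1 - C₁ * Real.exp (-C₂ * N) ≤ lam l

/-- The `N × N` matrix whose columns are the DPSS vectors. -/
def dpssMatrix {N : ℕ} (s : Fin N → ℤ → ℝ) : Matrix (Fin N) (Fin N) ℂ :=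
  Matrix.of fun n l => (s l ((n : ℕ) : ℤ) : ℂ)

/-- The `N × N` diagonal modulation matrix with entries `e^{j2πfn}`. -/
def modulation (N : ℕ) (f : ℝ) : Matrix (Fin N) (Fin N) ℂ :=
  Matrix.diagonal fun n => Complex.exp ((2 * Real.pi * f * (n : ℕ) : ℝ) * Complex.I)

/-- The first `k` columns of a matrix with `N` columns. -/
def firstColumns {N k : ℕ} (hk : k ≤ N) (A : Matrix (Fin N) (Fin N) ℂ) :
    Matrix (Fin N) (Fin k) ℂ :=
  A.submatrix id (Fin.castLE hk)

/-- Midpoint `F_i` of the `i`-th band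
`[-Bnyq/2 + i Bband, -Bnyq/2 + (i+1) Bband]`. -/
def bandCenter (Bnyq Bband : ℝ) (i : ℕ) : ℝ :=
  -Bnyq / 2 + ((i : ℝ) + 1 / 2) * Bband

/-- The multiband modulated DPSS dictionary `[Ψ₀ Ψ₁ ⋯ Ψ_{J-1}]`: the block `Ψ_i` consists of the
first `k` columns of `E_{f_i} S`, with `f_i = F_i Ts`. The column `(i, l)` is the `l`-th column
of the `i`-th block. -/
def dictionary {N k : ℕ} (s : Fin N → ℤ → ℝ) (hk : k ≤ N) (J : ℕ) (Bnyq Bband Ts : ℝ) :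
    Matrix (Fin N) (Fin J × Fin k) ℂ :=
  Matrix.of fun n p =>
    firstColumns hk (modulation N (bandCenter Bnyq Bband (p.1 : ℕ) * Ts) * dpssMatrix s) n p.2

end

end MultibandDPSS

namespace MultibandDPSS

open Complex ComplexConjugate

/-! Both parts rest on the eigenvalue equation in weak form (`IsDPSS.integral_trigPoly`): pairing `s
l` with any vector over the band `[-W, W]` gives `lam l` times their time-domain pairing. Hence the
windowed DPSS's are orthonormal, and by Parseval `s l` has energy `lam l` in the band and `1 - lam
l` outside it.

Coherence: columns in one block are orthogonal. For different blocks, the relative modulation moves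
one spectrum so that the base band sees only its out-of-band energy. Cauchy–Schwarz and the weak
equation then bound the inner product by `2√δ`, with `δ = C₁ e^{-C₂N}`
(`IsDPSS.norm_sum_modulated_le`).

Clustering: a vector in the span of the `s j`, `j ≥ l`, has at least the fraction `1 - lam l` of its
energy outside the band. Dimension counting gives a nonzero one whose DTFT vanishes on a grid of
spacing `1/(N+L)` across the slightly widened out-of-band interval. Oversampled interpolation with a
localized kernel makes that DTFT exponentially small there, so `1 - lam l` is exponentially small.
-/

/-! ### Trigonometric polynomials as DTFTs of finite vectors. -/

/-- The trigonometric polynomial `∑ n, a n e^{-j2πfn}`, the DTFT of a finite vector. -/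
noncomputable def trigPoly {N : ℕ} (a : Fin N → ℂ) (f : ℝ) : ℂ :=
  ∑ n, a n * cexp (-(2 * Real.pi * f * (n : ℕ) : ℝ) * I)

/-- The time-limited part of a real sequence, as a complex vector. -/
def window (N : ℕ) (x : ℤ → ℝ) (n : Fin N) : ℂ := (x ((n : ℕ) : ℤ) : ℂ)

lemma tsum_int_eq_sum_fin {R : Type*} [AddCommMonoid R] [TopologicalSpace R] (N : ℕ)
    (F : ℤ → R) (hF : ∀ n, ¬ (0 ≤ n ∧ n < (N : ℤ)) → F n = 0) :
    ∑' n, F n = ∑ n : Fin N, F ((n : ℕ) : ℤ) := by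
  have hinj : Function.Injective (fun n : Fin N => ((n : ℕ) : ℤ)) := fun a b h => by
    simpa [Fin.ext_iff] using h
  rw [← hinj.tsum_eq, tsum_fintype]
  intro n hn
  have h : 0 ≤ n ∧ n < (N : ℤ) := by
    by_contra h
    exact hn (hF n h)
  exact ⟨⟨n.toNat, by omega⟩, by simp [h.1]⟩

lemma dtft_timeLimit {N : ℕ} (x : ℤ → ℝ) (f : ℝ) :
    dtft (timeLimit N (fun m => (x m : ℂ))) f = trigPoly (window N x) f := by
  unfold dtft trigPoly window
  rw [tsum_int_eq_sum_fin N]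
  · refine Finset.sum_congr rfl fun n _ => ?_
    simp [timeLimit]
  · intro n hn
    simp [timeLimit, hn]

@[fun_prop]
lemma continuous_trigPoly {N : ℕ} (a : Fin N → ℂ) : Continuous (trigPoly a) := by
  unfold trigPoly
  fun_prop

lemma conj_trigPoly {N : ℕ} (a : Fin N → ℂ) (f : ℝ) :
    conj (trigPoly a f) = ∑ n, conj (a n) * cexp ((2 * Real.pi * f * (n : ℕ) : ℝ) * I) := by
  simp only [trigPoly, map_sum, map_mul, ← exp_conj, map_neg, conj_I, conj_ofReal]
  simp

lemma norm_sq_eq_mul_conj (z : ℂ) : ((‖z‖ ^ 2 : ℝ) : ℂ) = z * conj z := by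
  rw [mul_conj, normSq_eq_norm_sq]

lemma trigPoly_sum_mul {N : ℕ} {ι : Type*} (t : Finset ι) (c : ι → ℂ) (a : ι → Fin N → ℂ)
    (f : ℝ) :
    trigPoly (fun n => ∑ j ∈ t, c j * a j n) f = ∑ j ∈ t, c j * trigPoly (a j) f := by
  simp only [trigPoly, Finset.sum_mul, Finset.mul_sum]
  rw [Finset.sum_comm]
  simp only [mul_assoc]

/-! ### Weak eigenvalue equation, Parseval, orthonormality and band energies. -/

lemma IsDPSS.integral_trigPoly {N : ℕ} {W : ℝ} {s : Fin N → ℤ → ℝ} {lam : Fin N → ℝ}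
    (h : IsDPSS N W s lam) (l : Fin N) (b : Fin N → ℂ) :
    ∫ f in (-W)..W, trigPoly (window N (s l)) f * conj (trigPoly b f)
      = lam l * ∑ n, window N (s l) n * conj (b n) := by
  have hint : ∀ n : Fin N, (∫ f in (-W)..W, trigPoly (window N (s l)) f *
      cexp ((2 * Real.pi * f * (n : ℕ) : ℝ) * I)) = lam l * window N (s l) n := by
    intro n
    have := h.eigen l ((n : ℕ) : ℤ)
    simpa only [bandLimit, dtft_timeLimit, Int.cast_natCast, window] using this
  simp only [conj_trigPoly, Finset.mul_sum]
  rw [intervalIntegral.integral_finsetSum]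
  · refine Finset.sum_congr rfl fun n _ => ?_
    have e : ∀ f : ℝ, trigPoly (window N (s l)) f *
        (conj (b n) * cexp ((2 * Real.pi * f * (n : ℕ) : ℝ) * I)) =
        conj (b n) * (trigPoly (window N (s l)) f *
          cexp ((2 * Real.pi * f * (n : ℕ) : ℝ) * I)) := fun f => by ring
    simp only [e]
    rw [intervalIntegral.integral_const_mul, hint]
    ring
  · intro n _
    apply Continuous.intervalIntegrable
    fun_prop

lemma integral_exp_int (u : ℝ) (k : ℤ) :
    ∫ t in u..(u + 1), cexp (2 * Real.pi * k * I * t) = if k = 0 then 1 else 0 := by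
  split_ifs with hk
  · simp [hk]
  · have hc : 2 * (Real.pi : ℂ) * k * I ≠ 0 := by
      simp [hk, Real.pi_ne_zero]
    rw [integral_exp_mul_complex hc]
    have : cexp (2 * Real.pi * k * I * ((u + 1 : ℝ) : ℂ)) = cexp (2 * Real.pi * k * I * u) := by
      rw [exp_eq_exp_iff_exists_int]
      exact ⟨k, by push_cast; ring⟩
    rw [this, sub_self, zero_div]

lemma integral_trigPoly_period {N : ℕ} (a b : Fin N → ℂ) (u : ℝ) :
    ∫ f in u..(u + 1), trigPoly a f * conj (trigPoly b f) = ∑ n, a n * conj (b n) := by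
  have e : ∀ f : ℝ, trigPoly a f * conj (trigPoly b f) =
      ∑ n : Fin N, ∑ m : Fin N, a n * conj (b m) *
        cexp (2 * Real.pi * ((((m : ℕ) : ℤ) - ((n : ℕ) : ℤ) : ℤ) : ℂ) * I * f) := fun f => by
    rw [conj_trigPoly, trigPoly, Finset.sum_mul_sum]
    refine Finset.sum_congr rfl fun n _ => Finset.sum_congr rfl fun m _ => ?_
    rw [mul_mul_mul_comm, ← exp_add]
    congr 2
    push_cast
    ring
  simp only [e]
  rw [intervalIntegral.integral_finsetSum]
  · refine Finset.sum_congr rfl fun n _ => ?_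
    rw [intervalIntegral.integral_finsetSum, Finset.sum_eq_single n]
    · rw [intervalIntegral.integral_const_mul, integral_exp_int]
      simp
    · intro m _ hm
      rw [intervalIntegral.integral_const_mul, integral_exp_int, if_neg, mul_zero]
      intro h0
      exact hm (Fin.ext (by omega))
    · simp
    · intro m _
      apply Continuous.intervalIntegrable
      fun_prop
  · intro n _
    apply Continuous.intervalIntegrable
    fun_prop

lemma integral_norm_sq_trigPoly_period {N : ℕ} (a : Fin N → ℂ) (u : ℝ) :
    ∫ f in u..(u + 1), ‖trigPoly a f‖ ^ 2 = ∑ n, ‖a n‖ ^ 2 := by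
  have := integral_trigPoly_period a a u
  simp only [← norm_sq_eq_mul_conj] at this
  rw [intervalIntegral.integral_ofReal] at this
  exact_mod_cast this

lemma IsDPSS.sum_sq {N : ℕ} {W : ℝ} {s : Fin N → ℤ → ℝ} {lam : Fin N → ℝ}
    (h : IsDPSS N W s lam) (l : Fin N) : ∑ n : Fin N, s l ((n : ℕ) : ℤ) ^ 2 = 1 := by
  rw [← h.normalized l, tsum_int_eq_sum_fin N]
  · simp [timeLimit]
  · intro n hn
    simp [timeLimit, hn]

/-- The in-band pairing is Hermitian, so evaluating it from either side gives the same sum with two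
distinct eigenvalues as factors. -/
lemma IsDPSS.sum_mul_of_ne {N : ℕ} {W : ℝ} {s : Fin N → ℤ → ℝ} {lam : Fin N → ℝ}
    (h : IsDPSS N W s lam) {l m : Fin N} (hlm : l ≠ m) :
    ∑ n : Fin N, s l ((n : ℕ) : ℤ) * s m ((n : ℕ) : ℤ) = 0 := by
  have h1 := h.integral_trigPoly l (window N (s m))
  have h2 := congrArg conj (h.integral_trigPoly m (window N (s l)))
  rw [← intervalIntegral.intervalIntegral_conj] at h2
  simp only [map_mul, conj_conj, conj_ofReal, map_sum] at h2
  simp only [mul_comm (conj _) _] at h2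
  rw [h1] at h2
  simp only [window, conj_ofReal] at h2
  have h3 : lam l * ∑ n : Fin N, s l ((n : ℕ) : ℤ) * s m ((n : ℕ) : ℤ) =
      lam m * ∑ n : Fin N, s l ((n : ℕ) : ℤ) * s m ((n : ℕ) : ℤ) := by exact_mod_cast h2
  have hne : lam l - lam m ≠ 0 := sub_ne_zero.mpr fun e => hlm (h.lam_strictAnti.injective e)
  have : (lam l - lam m) * ∑ n : Fin N, s l ((n : ℕ) : ℤ) * s m ((n : ℕ) : ℤ) = 0 := by
    rw [sub_mul, h3, sub_self]
  exact (mul_eq_zero.mp this).resolve_left hne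

lemma IsDPSS.sum_window_mul_conj {N : ℕ} {W : ℝ} {s : Fin N → ℤ → ℝ} {lam : Fin N → ℝ}
    (h : IsDPSS N W s lam) (l m : Fin N) :
    ∑ n : Fin N, window N (s l) n * conj (window N (s m) n) = if l = m then 1 else 0 := by
  simp only [window, conj_ofReal]
  split_ifs with e
  · subst e
    have := h.sum_sq l
    simp only [sq] at this
    exact_mod_cast this
  · exact_mod_cast h.sum_mul_of_ne e

lemma IsDPSS.sum_norm_sq_window {N : ℕ} {W : ℝ} {s : Fin N → ℤ → ℝ} {lam : Fin N → ℝ}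
    (h : IsDPSS N W s lam) (l : Fin N) : ∑ n : Fin N, ‖window N (s l) n‖ ^ 2 = 1 := by
  simpa [window] using h.sum_sq l

/-- The energy outside the band is what is missing from the energy inside the band. -/
lemma integral_norm_sq_outside {N : ℕ} (W : ℝ) (a : Fin N → ℂ) :
    ∫ f in W..(1 - W), ‖trigPoly a f‖ ^ 2 =
      ∑ n, ‖a n‖ ^ 2 - ∫ f in (-W)..W, ‖trigPoly a f‖ ^ 2 := by
  have hc : Continuous fun f => ‖trigPoly a f‖ ^ 2 := by fun_prop
  rw [← integral_norm_sq_trigPoly_period a (-W), show -W + 1 = 1 - W by ring,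
    ← intervalIntegral.integral_add_adjacent_intervals (hc.intervalIntegrable (-W) W)
      (hc.intervalIntegrable W (1 - W))]
  ring

lemma IsDPSS.integral_norm_sq_band {N : ℕ} {W : ℝ} {s : Fin N → ℤ → ℝ} {lam : Fin N → ℝ}
    (h : IsDPSS N W s lam) (l : Fin N) :
    ∫ f in (-W)..W, ‖trigPoly (window N (s l)) f‖ ^ 2 = lam l := by
  have := h.integral_trigPoly l (window N (s l))
  rw [h.sum_window_mul_conj, if_pos rfl, mul_one] at this
  simp only [← norm_sq_eq_mul_conj] at this
  rw [intervalIntegral.integral_ofReal] at this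
  exact_mod_cast this

lemma IsDPSS.integral_norm_sq_outside {N : ℕ} {W : ℝ} {s : Fin N → ℤ → ℝ} {lam : Fin N → ℝ}
    (h : IsDPSS N W s lam) (l : Fin N) :
    ∫ f in W..(1 - W), ‖trigPoly (window N (s l)) f‖ ^ 2 = 1 - lam l := by
  rw [MultibandDPSS.integral_norm_sq_outside, h.integral_norm_sq_band, h.sum_norm_sq_window]

/-! ### Near-orthogonality of modulated DPSS vectors. -/

lemma trigPoly_modulated {N : ℕ} (a : Fin N → ℂ) (d f : ℝ) :
    trigPoly (fun n => cexp (-(2 * Real.pi * d * (n : ℕ) : ℝ) * I) * a n) f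
      = trigPoly a (f + d) := by
  simp only [trigPoly]
  refine Finset.sum_congr rfl fun n _ => ?_
  rw [mul_comm (cexp _) (a n), mul_assoc, ← exp_add]
  congr 2
  push_cast
  ring

/-- Cauchy–Schwarz in its weighted AM–GM form; the weight `t` is left free for balancing the two
energies. -/
lemma norm_integral_trigPoly_le {N : ℕ} (W : ℝ) (hW : 0 ≤ W) (a b : Fin N → ℂ) (t : ℝ)
    (ht : 0 < t) :
    ‖∫ f in (-W)..W, trigPoly a f * conj (trigPoly b f)‖ ≤
      (t * ∫ f in (-W)..W, ‖trigPoly a f‖ ^ 2) / 2 +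
        (t⁻¹ * ∫ f in (-W)..W, ‖trigPoly b f‖ ^ 2) / 2 := by
  have h1 : Continuous fun f => t * ‖trigPoly a f‖ ^ 2 / 2 := by fun_prop
  have h2 : Continuous fun f => t⁻¹ * ‖trigPoly b f‖ ^ 2 / 2 := by fun_prop
  calc _ ≤ ∫ f in (-W)..W, (t * ‖trigPoly a f‖ ^ 2 / 2 + t⁻¹ * ‖trigPoly b f‖ ^ 2 / 2) := by
        refine intervalIntegral.norm_integral_le_of_norm_le (by linarith)
          (Filter.Eventually.of_forall fun f _ => ?_) ((h1.add h2).intervalIntegrable _ _)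
        rw [norm_mul, RCLike.norm_conj]
        have hx := norm_nonneg (trigPoly a f)
        have : 0 ≤ t⁻¹ * (t * ‖trigPoly a f‖ - ‖trigPoly b f‖) ^ 2 := by positivity
        have e : t⁻¹ * (t * ‖trigPoly a f‖ - ‖trigPoly b f‖) ^ 2 =
            t * ‖trigPoly a f‖ ^ 2 + t⁻¹ * ‖trigPoly b f‖ ^ 2
              - 2 * (‖trigPoly a f‖ * ‖trigPoly b f‖) := by
          field_simp
          ring
        linarith
    _ = _ := by
        rw [intervalIntegral.integral_add (h1.intervalIntegrable _ _)
          (h2.intervalIntegrable _ _)]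
        simp only [intervalIntegral.integral_div, intervalIntegral.integral_const_mul]

lemma norm_sum_mul_conj_le {N : ℕ} (a b : Fin N → ℂ) :
    ‖∑ n, a n * conj (b n)‖ ≤ (∑ n, ‖a n‖ ^ 2 + ∑ n, ‖b n‖ ^ 2) / 2 := by
  rw [← Finset.sum_add_distrib, Finset.sum_div]
  refine norm_sum_le_of_le _ fun n _ => ?_
  rw [norm_mul, RCLike.norm_conj]
  nlinarith [sq_nonneg (‖a n‖ - ‖b n‖)]

/-- Two DPSS vectors modulated to disjoint bands are nearly orthogonal. -/
lemma IsDPSS.norm_sum_modulated_le {N : ℕ} {W : ℝ} {s : Fin N → ℤ → ℝ} {lam : Fin N → ℝ}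
    (h : IsDPSS N W s lam) (hW : 0 ≤ W) {l m : Fin N} {δ : ℝ} (hδ : 0 < δ)
    (hl : 1 - δ ≤ lam l) (hm : 1 - δ ≤ lam m) {d : ℝ} (hd : 2 * W ≤ d) (hd' : d ≤ 1 - 2 * W) :
    ‖∑ n : Fin N, window N (s l) n *
        conj (cexp (-(2 * Real.pi * d * (n : ℕ) : ℝ) * I) * window N (s m) n)‖
      ≤ 2 * √δ := by
  set b : Fin N → ℂ := fun n => cexp (-(2 * Real.pi * d * (n : ℕ) : ℝ) * I) * window N (s m) n
  set S := ∑ n : Fin N, window N (s l) n * conj (b n)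
  have hδ' : 0 < √δ := Real.sqrt_pos.mpr hδ
  have hb : ∑ n, ‖b n‖ ^ 2 = 1 := by
    rw [← h.sum_norm_sq_window m]
    refine Finset.sum_congr rfl fun n _ => ?_
    rw [norm_mul, ← ofReal_neg, norm_exp_ofReal_mul_I, one_mul]
  have hS : ‖S‖ ≤ 1 := by
    have := norm_sum_mul_conj_le (window N (s l)) b
    rw [hb, h.sum_norm_sq_window] at this
    linarith
  -- Modulation translates the band to `[d - W, d + W]`, which lies in `[W, 1 - W]` by the bounds on
  -- `d`.
  have hout : ∫ f in (-W)..W, ‖trigPoly b f‖ ^ 2 ≤ δ := by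
    simp only [b, trigPoly_modulated]
    rw [intervalIntegral.integral_comp_add_right (fun f => ‖trigPoly (window N (s m)) f‖ ^ 2)]
    refine le_trans ?_ (by linarith : 1 - lam m ≤ δ)
    rw [← h.integral_norm_sq_outside m]
    refine intervalIntegral.integral_mono_interval (by linarith) (by linarith) (by linarith)
      (Filter.Eventually.of_forall fun f => by positivity) ?_
    apply Continuous.intervalIntegrable
    fun_prop
  -- The energies are at most `1` and `δ`, so the weight `√δ` makes each half at most `√δ / 2`.
  have hin := norm_integral_trigPoly_le W hW (window N (s l)) b (√δ) hδ'
  rw [h.integral_norm_sq_band, h.integral_trigPoly] at hin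
  have hin' : ‖(lam l : ℂ) * S‖ ≤ √δ := by
    refine hin.trans ?_
    have h1 : √δ * lam l ≤ √δ := by nlinarith [h.lam_lt_one l]
    have h2 : (√δ)⁻¹ * ∫ f in (-W)..W, ‖trigPoly b f‖ ^ 2 ≤ √δ := by
      rw [inv_mul_le_iff₀ hδ', Real.mul_self_sqrt hδ.le]
      exact hout
    linarith
  -- Since `0 < 1 - lam l < 1`, its square is at most itself, hence at most `δ`.
  have hlam : 1 - lam l ≤ √δ := by
    have h0 := h.lam_pos l
    have h1 := h.lam_lt_one l
    apply Real.le_sqrt_of_sq_le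
    nlinarith
  -- This splitting avoids dividing by `lam l`, for which `1 - δ` may be a useless lower bound.
  have e : S = (lam l : ℂ) * S + ((1 - lam l : ℝ) : ℂ) * S := by
    push_cast
    ring
  calc ‖S‖ ≤ ‖(lam l : ℂ) * S‖ + ‖((1 - lam l : ℝ) : ℂ) * S‖ := by
        conv_lhs => rw [e]
        exact norm_add_le _ _
    _ ≤ √δ + √δ * 1 := by
        refine add_le_add hin' ?_
        rw [norm_mul, norm_real, Real.norm_of_nonneg (by linarith [h.lam_lt_one l])]
        exact mul_le_mul hlam hS (norm_nonneg _) hδ'.le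
    _ = 2 * √δ := by ring

/-- The common offset of the band centres cancels, leaving a modulation by the index difference
times `Bband * Ts = 2W`. -/
lemma inner_dictionary_col {N k J : ℕ} (s : Fin N → ℤ → ℝ) (hk : k ≤ N) (Bnyq Bband Ts : ℝ)
    (p q : Fin J × Fin k) :
    inner ℂ (WithLp.toLp 2 ((dictionary s hk J Bnyq Bband Ts).col p) : EuclideanSpace ℂ (Fin N))
        (WithLp.toLp 2 ((dictionary s hk J Bnyq Bband Ts).col q) : EuclideanSpace ℂ (Fin N))
      = ∑ n : Fin N, window N (s (Fin.castLE hk q.2)) n *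
          conj (cexp (-(2 * Real.pi * (((q.1 : ℕ) - (p.1 : ℕ) : ℝ) * (Bband * Ts)) *
            (n : ℕ) : ℝ) * I) * window N (s (Fin.castLE hk p.2)) n) := by
  rw [PiLp.inner_apply]
  refine Finset.sum_congr rfl fun n _ => ?_
  simp only [dictionary, firstColumns, modulation, dpssMatrix, bandCenter, window,
    Matrix.diagonal_mul, Matrix.col_apply, Matrix.of_apply, Matrix.submatrix_apply, id,
    RCLike.inner_apply, map_mul, conj_ofReal, ← exp_conj, map_neg, conj_I]
  rw [mul_mul_mul_comm, ← exp_add, mul_comm, mul_assoc, mul_comm (cexp _)]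
  congr 3
  push_cast
  ring

lemma IsDPSS.coherence_le {N k J : ℕ} {W ε C₁ C₂ : ℝ} {s : Fin N → ℤ → ℝ} {lam : Fin N → ℝ}
    (h : IsDPSS N W s lam) (hW : 0 < W) (hC₁ : 0 < C₁)
    (hcl : ∀ l : Fin N, ((l : ℕ) : ℝ) ≤ 2 * N * W * (1 - ε) →
      1 - C₁ * Real.exp (-C₂ * N) ≤ lam l)
    (hkN : k ≤ N) (hk : (k : ℝ) ≤ 2 * N * W * (1 - ε)) {Bnyq Bband Ts : ℝ}
    (hJ : J * (Bband * Ts) ≤ 1) (hWB : W = Bband * Ts / 2) {p q : Fin J × Fin k} (hpq : p ≠ q) :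
    ‖inner ℂ
        (WithLp.toLp 2 ((dictionary s hkN J Bnyq Bband Ts).col p) : EuclideanSpace ℂ (Fin N))
        (WithLp.toLp 2 ((dictionary s hkN J Bnyq Bband Ts).col q) : EuclideanSpace ℂ (Fin N))‖
      ≤ 3 * C₁ ^ (1 / 2 : ℝ) * Real.exp (-(C₂ * N / 2)) := by
  have hBT : Bband * Ts = 2 * W := by linarith
  have hnear : ∀ l : Fin k, 1 - C₁ * Real.exp (-C₂ * N) ≤ lam (Fin.castLE hkN l) := fun l => by
    apply hcl
    have : ((l : ℕ) : ℝ) ≤ k := by exact_mod_cast l.2.le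
    simpa using this.trans hk
  by_cases hi : p.1 = q.1
  · have hl : Fin.castLE hkN q.2 ≠ Fin.castLE hkN p.2 := fun e => by
      apply hpq
      exact Prod.ext hi (Fin.castLE_injective hkN e).symm
    have h0 := h.sum_window_mul_conj (Fin.castLE hkN q.2) (Fin.castLE hkN p.2)
    rw [if_neg hl] at h0
    rw [inner_dictionary_col, hi]
    simp only [sub_self, zero_mul, mul_zero, ofReal_zero, neg_zero, exp_zero, one_mul, h0,
      norm_zero]
    positivity
  wlog hlt : p.1 < q.1 generalizing p q
  · rw [norm_inner_symm]
    exact this hpq.symm (Ne.symm hi) (lt_of_le_of_ne (not_lt.mp hlt) (Ne.symm hi))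
  have hd1 : (1 : ℝ) ≤ (q.1 : ℕ) - (p.1 : ℕ) := by
    have : ((p.1 : ℕ) : ℝ) + 1 ≤ (q.1 : ℕ) := by exact_mod_cast hlt
    linarith
  have hd2 : ((q.1 : ℕ) - (p.1 : ℕ) : ℝ) ≤ J - 1 := by
    have h1 : ((q.1 : ℕ) : ℝ) + 1 ≤ J := by exact_mod_cast q.1.2
    have h2 : (0 : ℝ) ≤ (p.1 : ℕ) := Nat.cast_nonneg _
    linarith
  rw [hBT] at hJ
  have hδ : 0 < C₁ * Real.exp (-C₂ * N) := by positivity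
  rw [inner_dictionary_col, hBT]
  -- An index difference between `1` and `J - 1`, with `J * 2W ≤ 1`, puts the shift in `[2W, 1 -
  -- 2W]`.
  refine (h.norm_sum_modulated_le hW.le hδ (hnear q.2) (hnear p.2) (by nlinarith)
    (by nlinarith)).trans ?_
  rw [Real.sqrt_mul hC₁.le, ← Real.exp_half, Real.sqrt_eq_rpow, ← mul_assoc,
    show -C₂ * N / 2 = -(C₂ * N / 2) by ring]
  have : 0 ≤ C₁ ^ (1 / 2 : ℝ) := by positivity
  gcongr
  norm_num

lemma card_dictionary_lt {N k J : ℕ} {W ε : ℝ} (hN : 1 ≤ N) (hε : 0 < ε)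
    (hε1 : ε < 1) (hJ : J * (2 * W) ≤ 1) (hk : (k : ℝ) ≤ 2 * N * W * (1 - ε)) : k * J < N := by
  have hN' : (1 : ℝ) ≤ N := by exact_mod_cast hN
  have : (k : ℝ) * J < N := by
    calc (k : ℝ) * J ≤ 2 * N * W * (1 - ε) * J := by gcongr
      _ = N * (1 - ε) * (J * (2 * W)) := by ring
      _ ≤ N * (1 - ε) * 1 := by
          refine mul_le_mul_of_nonneg_left hJ (mul_nonneg (by linarith) (by linarith))
      _ < N := by nlinarith
  exact_mod_cast this

/-! ### Oversampled interpolation and exponential smallness. -/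

lemma sum_pow_mul_inv_pow {M : ℕ} {ζ : ℂ} (hζ : IsPrimitiveRoot ζ M) {m n : ℕ}
    (hm : m < M) (hn : n < M) :
    ∑ j ∈ Finset.range M, (ζ ^ m * (ζ⁻¹) ^ n) ^ j = if m = n then (M : ℂ) else 0 := by
  have h0 : ζ ≠ 0 := hζ.ne_zero (by omega)
  split_ifs with e
  · subst e
    simp [mul_inv_cancel₀ (pow_ne_zero m h0)]
  · have h1 : ζ ^ m * (ζ⁻¹) ^ n - 1 ≠ 0 := by
      intro h
      rw [sub_eq_zero, inv_pow, mul_inv_eq_one₀ (pow_ne_zero _ h0)] at h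
      exact e (hζ.pow_inj hm hn h)
    have h2 := mul_geom_sum (ζ ^ m * (ζ⁻¹) ^ n) M
    have h3 : (ζ ^ m * (ζ⁻¹) ^ n) ^ M = 1 := by
      rw [mul_pow, ← pow_mul, ← pow_mul, mul_comm m, mul_comm n, pow_mul, pow_mul, inv_pow,
        hζ.pow_eq_one]
      simp
    rw [h3, sub_self] at h2
    exact (mul_eq_zero.mp h2).resolve_left h1

lemma sum_eval_mul_inv_pow {M : ℕ} {ζ : ℂ} (hζ : IsPrimitiveRoot ζ M) (R : Polynomial ℂ)
    (hR : R.natDegree < M) {n : ℕ} (hn : n < M) :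
    ∑ j ∈ Finset.range M, R.eval (ζ ^ j) * ((ζ⁻¹) ^ n) ^ j = M * R.coeff n := by
  simp only [Polynomial.eval_eq_sum_range' hR, Finset.sum_mul]
  rw [Finset.sum_comm, Finset.sum_eq_single_of_mem n (Finset.mem_range.mpr hn)]
  · have := sum_pow_mul_inv_pow hζ hn hn
    rw [if_pos rfl] at this
    rw [← this, Finset.sum_mul]
    refine Finset.sum_congr rfl fun j _ => ?_
    rw [mul_pow, ← pow_mul ζ n, ← pow_mul ζ j]
    ring
  · intro m hm hmn
    have := sum_pow_mul_inv_pow hζ (Finset.mem_range.mp hm) hn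
    rw [if_neg hmn] at this
    rw [← mul_zero (R.coeff m), ← this, Finset.mul_sum]
    refine Finset.sum_congr rfl fun j _ => ?_
    rw [mul_pow, ← pow_mul ζ m, ← pow_mul ζ j]
    ring

/-- On the unit circle, a polynomial of degree less than `M` is bounded by the sum of its absolute
values at the `M`-th roots of unity. -/
lemma norm_eval_le_sum_norm_eval_roots {M : ℕ} {ζ : ℂ} (hζ : IsPrimitiveRoot ζ M)
    (R : Polynomial ℂ) (hR : R.natDegree < M) {w : ℂ} (hw : ‖w‖ = 1) :
    ‖R.eval w‖ ≤ ∑ j ∈ Finset.range M, ‖R.eval (ζ ^ j)‖ := by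
  have hM : 0 < M := by omega
  have hM' : (0 : ℝ) < M := by exact_mod_cast hM
  have hζ1 : ‖ζ‖ = 1 := hζ.norm'_eq_one hM.ne'
  -- By the inverse discrete Fourier transform each coefficient carries a factor `1 / M`, which
  -- summing `M` coefficients cancels.
  have hcoeff : ∀ n ∈ Finset.range M,
      ‖R.coeff n * w ^ n‖ ≤ (∑ j ∈ Finset.range M, ‖R.eval (ζ ^ j)‖) / M := by
    intro n hn
    rw [le_div_iff₀ hM', norm_mul, norm_pow, hw, one_pow, mul_one]
    have := sum_eval_mul_inv_pow hζ R hR (Finset.mem_range.mp hn)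
    calc ‖R.coeff n‖ * M = ‖(M : ℂ) * R.coeff n‖ := by
          rw [norm_mul, norm_natCast, mul_comm]
      _ ≤ _ := by
          rw [← this]
          refine norm_sum_le_of_le _ fun j _ => ?_
          simp [hζ1]
  rw [Polynomial.eval_eq_sum_range' hR]
  refine (norm_sum_le_of_le _ hcoeff).trans ?_
  rw [Finset.sum_const, Finset.card_range, nsmul_eq_mul, mul_div_cancel₀ _ hM'.ne']

lemma norm_one_add_exp_div_two (θ : ℝ) :
    ‖(1 + cexp ((2 * Real.pi * θ : ℝ) * I)) / 2‖ = |Real.cos (Real.pi * θ)| := by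
  have e : (1 + cexp ((2 * Real.pi * θ : ℝ) * I)) / 2 =
      cexp ((Real.pi * θ : ℝ) * I) * (Real.cos (Real.pi * θ) : ℝ) := by
    rw [ofReal_cos, Complex.cos, mul_div_assoc', mul_add, ← exp_add, ← exp_add]
    have e1 : ((Real.pi * θ : ℝ) : ℂ) * I + -((Real.pi * θ : ℝ) : ℂ) * I = 0 := by ring
    have e2 : ((Real.pi * θ : ℝ) : ℂ) * I + ((Real.pi * θ : ℝ) : ℂ) * I =
        (2 * Real.pi * θ : ℝ) * I := by
      push_cast
      ring
    rw [e1, e2, exp_zero, add_comm]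
  rw [e, norm_mul, norm_exp_ofReal_mul_I, one_mul, norm_real, Real.norm_eq_abs]

/-- Oversampled interpolation of a trigonometric polynomial with an exponentially localized
kernel. -/
lemma norm_trigPoly_le_sum {N : ℕ} (hN : 0 < N) (a : Fin N → ℂ) (L : ℕ) (f : ℝ) :
    ‖trigPoly a f‖ ≤ ∑ p ∈ Finset.range (N + L), ‖trigPoly a (p / (N + L : ℕ))‖ *
      |Real.cos (Real.pi * (f - p / (N + L : ℕ)))| ^ L := by
  set M := N + L with hMdef
  have hM : M ≠ 0 := by omega
  set ζ : ℂ := (cexp (2 * Real.pi * I / M))⁻¹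
  have hζ : IsPrimitiveRoot ζ M := (isPrimitiveRoot_exp M hM).inv
  -- The second factor is the kernel: it equals `1` at `e^{-j2πf}` and has modulus `|cos (π (f -
  -- g))| ^ L` at `e^{-j2πg}`. The degree is at most `N - 1 + L`, just below `M`.
  set R : Polynomial ℂ := (∑ n : Fin N, Polynomial.C (a n) * Polynomial.X ^ (n : ℕ)) *
    (Polynomial.C (1 / 2) + Polynomial.C (cexp ((2 * Real.pi * f : ℝ) * I) / 2) *
      Polynomial.X) ^ L
  have hR : R.natDegree < M := by
    have h1 : (∑ n : Fin N, Polynomial.C (a n) * Polynomial.X ^ (n : ℕ)).natDegree ≤ N - 1 := by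
      refine Polynomial.natDegree_sum_le_of_forall_le _ _ fun n _ => ?_
      exact (Polynomial.natDegree_C_mul_X_pow_le _ _).trans (by omega)
    have h2 : ((Polynomial.C (1 / 2) + Polynomial.C (cexp ((2 * Real.pi * f : ℝ) * I) / 2) *
        Polynomial.X) ^ L).natDegree ≤ L * 1 := by
      refine Polynomial.natDegree_pow_le_of_le _ ?_
      rw [add_comm]
      exact Polynomial.natDegree_linear_le
    have h3 := Polynomial.natDegree_mul_le_of_le h1 h2
    exact lt_of_le_of_lt h3 (by omega)
  have heval : ∀ g : ℝ, ‖R.eval (cexp (-(2 * Real.pi * g : ℝ) * I))‖ =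
      ‖trigPoly a g‖ * |Real.cos (Real.pi * (f - g))| ^ L := by
    intro g
    rw [Polynomial.eval_mul, norm_mul, Polynomial.eval_pow, norm_pow,
      ← norm_one_add_exp_div_two (f - g), Polynomial.eval_finsetSum]
    congr 3
    · funext n
      rw [Polynomial.eval_C_mul, Polynomial.eval_X_pow, ← exp_nat_mul]
      congr 2
      push_cast
      ring
    · rw [Polynomial.eval_add, Polynomial.eval_C, Polynomial.eval_C_mul, Polynomial.eval_X,
        div_mul_eq_mul_div, ← exp_add, add_div]
      congr 3
      push_cast
      ring
  have hroot : ∀ p : ℕ, ζ ^ p = cexp (-(2 * Real.pi * (p / M : ℝ) : ℝ) * I) := by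
    intro p
    rw [inv_pow, ← exp_nat_mul, ← exp_neg]
    congr 1
    push_cast
    ring
  have hw : ‖cexp (-(2 * Real.pi * f : ℝ) * I)‖ = 1 := by
    rw [← ofReal_neg, norm_exp_ofReal_mul_I]
  have := norm_eval_le_sum_norm_eval_roots hζ R hR hw
  rw [heval] at this
  simpa only [hroot, heval, sub_self, mul_zero, Real.cos_zero, abs_one, one_pow, mul_one]
    using this

lemma abs_cos_pi_mul_le {δ θ : ℝ} (hδ : 0 ≤ δ) (h1 : δ ≤ θ) (h2 : θ ≤ 1 - δ) :
    |Real.cos (Real.pi * θ)| ≤ Real.cos (Real.pi * δ) := by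
  have hpi := Real.pi_pos
  rw [abs_le]
  constructor
  · rw [← Real.cos_pi_sub]
    apply Real.cos_le_cos_of_nonneg_of_le_pi <;> nlinarith
  · apply Real.cos_le_cos_of_nonneg_of_le_pi <;> nlinarith

lemma norm_trigPoly_sq_le {N : ℕ} (a : Fin N → ℂ) (f : ℝ) :
    ‖trigPoly a f‖ ^ 2 ≤ N * ∑ n, ‖a n‖ ^ 2 := by
  have h1 : ‖trigPoly a f‖ ≤ ∑ n, ‖a n‖ := by
    refine norm_sum_le_of_le _ fun n _ => ?_
    rw [norm_mul, ← ofReal_neg, norm_exp_ofReal_mul_I, mul_one]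
  have h2 := sq_sum_le_card_mul_sum_sq (s := Finset.univ) (f := fun n => ‖a n‖)
  rw [Finset.card_univ, Fintype.card_fin] at h2
  exact (pow_le_pow_left₀ (norm_nonneg _) h1 2).trans h2

/-- A trigonometric polynomial that vanishes at all grid points near `[W, 1 - W]` is exponentially
small on `[W, 1 - W]`. -/
lemma norm_trigPoly_sq_le_of_vanish {N : ℕ} (hN : 0 < N) (a : Fin N → ℂ) (L : ℕ) {W δ : ℝ}
    (hδ : 0 ≤ δ) (hδW : δ ≤ W)
    (hv : ∀ p : ℕ, p < N + L → W - δ < p / (N + L : ℕ) → (p : ℝ) / (N + L : ℕ) < 1 - W + δ →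
      trigPoly a (p / (N + L : ℕ)) = 0)
    {f : ℝ} (hf : W ≤ f) (hf' : f ≤ 1 - W) :
    ‖trigPoly a f‖ ^ 2 ≤
      (N + L : ℕ) ^ 2 * N * Real.cos (Real.pi * δ) ^ (2 * L) * ∑ n, ‖a n‖ ^ 2 := by
  set M := N + L
  have hM : (0 : ℝ) < M := by exact_mod_cast (by omega : 0 < M)
  set E := ∑ n, ‖a n‖ ^ 2
  have hE : 0 ≤ N * E := by positivity
  have hc : 0 ≤ Real.cos (Real.pi * δ) := by
    have := abs_cos_pi_mul_le hδ hδW (by linarith : W ≤ 1 - δ)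
    exact (abs_nonneg _).trans this
  have hterm : ∀ p ∈ Finset.range M, ‖trigPoly a (p / M)‖ *
      |Real.cos (Real.pi * (f - p / M))| ^ L ≤ √(N * E) * Real.cos (Real.pi * δ) ^ L := by
    intro p hp
    have hp := Finset.mem_range.mp hp
    have hp1 : (p : ℝ) / M < 1 := by
      rw [div_lt_one hM]
      exact_mod_cast hp
    have hp0 : (0 : ℝ) ≤ p / M := by positivity
    -- Grid points inside the widened interval contribute nothing; the others have `|f - p / M|` in
    -- `[δ, 1 - δ]`, where the kernel is small.
    by_cases h1 : W - δ < p / M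
    · by_cases h2 : (p : ℝ) / M < 1 - W + δ
      · rw [hv p hp h1 h2, norm_zero, zero_mul]
        positivity
      · gcongr
        · exact Real.le_sqrt_of_sq_le (norm_trigPoly_sq_le a _)
        · rw [← Real.cos_neg, ← mul_neg]
          apply abs_cos_pi_mul_le hδ <;> linarith
    · gcongr
      · exact Real.le_sqrt_of_sq_le (norm_trigPoly_sq_le a _)
      · apply abs_cos_pi_mul_le hδ <;> linarith
  have h := (norm_trigPoly_le_sum hN a L f).trans (Finset.sum_le_sum hterm)
  rw [Finset.sum_const, Finset.card_range, nsmul_eq_mul] at h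
  refine (pow_le_pow_left₀ (norm_nonneg _) h 2).trans (le_of_eq ?_)
  rw [mul_pow, mul_pow, Real.sq_sqrt hE, ← pow_mul, mul_comm L 2]
  ring

/-! ### Variational bound and dimension counting. -/

/-- A combination of the DPSS vectors of index at least `l` has at most the fraction `lam l` of its
energy in the band. -/
lemma IsDPSS.one_sub_mul_le_integral_outside {N : ℕ} {W : ℝ} {s : Fin N → ℤ → ℝ}
    {lam : Fin N → ℝ} (h : IsDPSS N W s lam) (l : Fin N) (c : Fin N → ℂ) :
    let v : Fin N → ℂ := fun n => ∑ j ∈ Finset.Ici l, c j * window N (s j) n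
    ∑ n, ‖v n‖ ^ 2 = ∑ j ∈ Finset.Ici l, ‖c j‖ ^ 2 ∧
      (1 - lam l) * ∑ n, ‖v n‖ ^ 2 ≤ ∫ f in W..(1 - W), ‖trigPoly v f‖ ^ 2 := by
  intro v
  have hinner : ∀ j ∈ Finset.Ici l, ∑ n, window N (s j) n * conj (v n) = conj (c j) := by
    intro j hj
    simp only [v, map_sum, map_mul, Finset.mul_sum]
    rw [Finset.sum_comm]
    have e : ∀ m : Fin N, ∑ n, window N (s j) n * (conj (c m) * conj (window N (s m) n)) =
        conj (c m) * if j = m then 1 else 0 := fun m => by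
      rw [← h.sum_window_mul_conj, Finset.mul_sum]
      exact Finset.sum_congr rfl fun n _ => by ring
    simp only [e, mul_ite, mul_one, mul_zero, Finset.sum_ite_eq, if_pos hj]
  have hnorm : ∑ n, ‖v n‖ ^ 2 = ∑ j ∈ Finset.Ici l, ‖c j‖ ^ 2 := by
    have : ∑ n, v n * conj (v n) = ∑ j ∈ Finset.Ici l, c j * conj (c j) := by
      calc ∑ n, v n * conj (v n)
          = ∑ n, ∑ j ∈ Finset.Ici l, c j * (window N (s j) n * conj (v n)) :=
            Finset.sum_congr rfl fun n _ => by
              conv_lhs => rw [show v n = ∑ j ∈ Finset.Ici l, c j * window N (s j) n from rfl,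
                Finset.sum_mul]
              exact Finset.sum_congr rfl fun j _ => by ring
        _ = _ := by
            rw [Finset.sum_comm]
            refine Finset.sum_congr rfl fun j hj => ?_
            rw [← Finset.mul_sum, hinner j hj]
    simp only [← norm_sq_eq_mul_conj] at this
    exact_mod_cast this
  have hband : ∫ f in (-W)..W, ‖trigPoly v f‖ ^ 2 = ∑ j ∈ Finset.Ici l, lam j * ‖c j‖ ^ 2 := by
    have : ∫ f in (-W)..W, trigPoly v f * conj (trigPoly v f) =
        ∑ j ∈ Finset.Ici l, lam j * (c j * conj (c j)) := by
      have e : ∀ f, trigPoly v f * conj (trigPoly v f) =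
          ∑ j ∈ Finset.Ici l, c j * (trigPoly (window N (s j)) f * conj (trigPoly v f)) := by
        intro f
        rw [show trigPoly v f = ∑ j ∈ Finset.Ici l, c j * trigPoly (window N (s j)) f from
          trigPoly_sum_mul _ _ _ _, Finset.sum_mul]
        exact Finset.sum_congr rfl fun j _ => by ring
      simp only [e]
      rw [intervalIntegral.integral_finsetSum]
      · refine Finset.sum_congr rfl fun j hj => ?_
        rw [intervalIntegral.integral_const_mul, h.integral_trigPoly, hinner j hj]
        ring
      · intro j _
        apply Continuous.intervalIntegrable
        exact continuous_const.mul ((continuous_trigPoly _).mul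
          (continuous_conj.comp (continuous_trigPoly _)))
    simp only [← norm_sq_eq_mul_conj] at this
    rw [intervalIntegral.integral_ofReal] at this
    exact_mod_cast this
  refine ⟨hnorm, ?_⟩
  rw [MultibandDPSS.integral_norm_sq_outside, hband, hnorm, sub_mul, one_mul, Finset.mul_sum]
  gcongr with j hj
  exact h.lam_strictAnti.antitone (Finset.mem_Ici.mp hj)

/-- The grid points `p / M` in the open interval `(u, v)`. -/
noncomputable def gridPoints (M : ℕ) (u v : ℝ) : Finset ℕ :=
  (Finset.range M).filter fun p => u < (p : ℝ) / M ∧ (p : ℝ) / M < v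

lemma card_gridPoints_le (M : ℕ) {u v : ℝ} (hu : 0 ≤ u) (huv : u ≤ v) :
    ((gridPoints M u v).card : ℝ) ≤ M * (v - u) + 1 := by
  have hsub : gridPoints M u v ⊆ Finset.Ioc ⌊M * u⌋₊ ⌊M * v⌋₊ := by
    intro p hp
    obtain ⟨h1, h2, h3⟩ := by simpa [gridPoints] using hp
    have hM : (0 : ℝ) < M := by exact_mod_cast (by omega : 0 < M)
    rw [lt_div_iff₀ hM] at h2
    rw [div_lt_iff₀ hM] at h3
    rw [Finset.mem_Ioc]
    constructor
    · rw [Nat.floor_lt (by positivity)]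
      linarith
    · exact Nat.le_floor (by linarith)
  have h1 := Finset.card_le_card hsub
  rw [Nat.card_Ioc] at h1
  have h2 : ⌊M * u⌋₊ ≤ ⌊M * v⌋₊ := Nat.floor_mono (by gcongr)
  have h3 : ((gridPoints M u v).card : ℝ) ≤ (⌊M * v⌋₊ : ℝ) - ⌊M * u⌋₊ := by
    rw [← Nat.cast_sub h2]
    exact_mod_cast h1
  have h4 := Nat.floor_le (mul_nonneg (Nat.cast_nonneg M) (hu.trans huv))
  have h5 := Nat.lt_floor_add_one (M * u)
  linarith

/-- There are fewer vanishing conditions than the `N - l` free coefficients, so a nonzero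
combination satisfies them all; its out-of-band energy is squeezed between the variational and
interpolation bounds. -/
lemma IsDPSS.one_sub_lam_le {N : ℕ} {W : ℝ} {s : Fin N → ℤ → ℝ} {lam : Fin N → ℝ}
    (h : IsDPSS N W s lam) (hW : W < 1 / 2) (l : Fin N) (L : ℕ) {δ : ℝ}
    (hδ : 0 ≤ δ) (hδW : δ ≤ W)
    (hcard : (gridPoints (N + L) (W - δ) (1 - W + δ)).card < N - l) :
    1 - lam l ≤ (N + L : ℕ) ^ 2 * N * Real.cos (Real.pi * δ) ^ (2 * L) := by
  have hN : 0 < N := l.pos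
  set B := gridPoints (N + L) (W - δ) (1 - W + δ)
  let T : (↥(Finset.Ici l) → ℂ) →ₗ[ℂ] (B → ℂ) :=
    Matrix.mulVecLin (Matrix.of fun (p : B) (j : ↥(Finset.Ici l)) =>
      trigPoly (window N (s j)) ((p : ℕ) / (N + L : ℕ)))
  have hT : LinearMap.ker T ≠ ⊥ := by
    apply LinearMap.ker_ne_bot_of_finrank_lt
    rwa [Module.finrank_pi, Module.finrank_pi, Fintype.card_coe, Fintype.card_coe, Fin.card_Ici]
  obtain ⟨c', hc', hc0⟩ := (Submodule.ne_bot_iff _).mp hT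
  let c : Fin N → ℂ := fun j => if hj : j ∈ Finset.Ici l then c' ⟨j, hj⟩ else 0
  have hcc' : ∀ j : ↥(Finset.Ici l), c j = c' j := fun j => by
    simp only [c, dif_pos j.2]
  obtain ⟨hnorm, hout⟩ := h.one_sub_mul_le_integral_outside l c
  set v : Fin N → ℂ := fun n => ∑ j ∈ Finset.Ici l, c j * window N (s j) n
  have hvan : ∀ p ∈ B, trigPoly v ((p : ℕ) / (N + L : ℕ)) = 0 := by
    intro p hp
    have h1 := congrFun (LinearMap.mem_ker.mp hc') ⟨p, hp⟩
    rw [Matrix.mulVecLin_apply, Matrix.mulVec, dotProduct, Pi.zero_apply] at h1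
    rw [trigPoly_sum_mul, ← h1, ← Finset.sum_coe_sort]
    refine Finset.sum_congr rfl fun j _ => ?_
    rw [hcc', mul_comm, Matrix.of_apply]
  have hpos : 0 < ∑ n, ‖v n‖ ^ 2 := by
    rw [hnorm]
    obtain ⟨j, hj⟩ := Function.ne_iff.mp hc0
    refine Finset.sum_pos' (fun _ _ => by positivity) ⟨j, j.2, ?_⟩
    rw [hcc']
    have : c' j ≠ 0 := hj
    positivity
  have hbound : ∫ f in W..(1 - W), ‖trigPoly v f‖ ^ 2 ≤
      ∫ _ in W..(1 - W), (N + L : ℕ) ^ 2 * N * Real.cos (Real.pi * δ) ^ (2 * L) *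
        ∑ n, ‖v n‖ ^ 2 := by
    refine intervalIntegral.integral_mono_on (by linarith) ?_ (by simp) fun f hf => ?_
    · apply Continuous.intervalIntegrable
      exact (continuous_trigPoly v).norm.pow 2
    · refine norm_trigPoly_sq_le_of_vanish hN v L hδ hδW (fun p h1 h2 h3 => hvan p ?_) hf.1 hf.2
      simp only [B, gridPoints, Finset.mem_filter, Finset.mem_range]
      exact ⟨h1, h2, h3⟩
  rw [intervalIntegral.integral_const, smul_eq_mul, ← mul_assoc] at hbound
  refine (le_of_mul_le_mul_right (hout.trans hbound) hpos).trans ?_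
  -- The interval length `1 - 2W` is at most `1` and is dropped.
  refine mul_le_of_le_one_left ?_ (by linarith)
  rw [pow_mul']
  positivity

/-! ### Choice of the constants. -/

lemma eventually_pow_three_mul_pow_le (A : ℝ) {r : ℝ} (h0 : 0 ≤ r) (h1 : r < 1) :
    ∀ᶠ N : ℕ in Filter.atTop, A * ((N : ℝ) ^ 3 * r ^ N) ≤ 1 := by
  have := (tendsto_pow_const_mul_const_pow_of_lt_one 3 h0 h1).const_mul A
  rw [mul_zero] at this
  exact this.eventually_le_const one_pos

lemma exists_clusterNearOne {W ε : ℝ} (hW : 0 < W) (hW2 : W < 1 / 2) (hε : 0 < ε) (hε1 : ε < 1) :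
    ∃ (C₂ : ℝ) (N₀ : ℕ), ClusterNearOne W ε 1 C₂ N₀ := by
  have hWε : 0 < W * ε := mul_pos hW hε
  have hWε1 : W * ε < W := by nlinarith
  -- Of the slack `2NWε` in the bound on `l`, widening by `δ` on both sides costs `NWε / 2` and
  -- oversampling by `L ≤ ηN` at most as much; the remaining `NWε > 1` absorbs the `+ 1` of the grid
  -- count.
  set η := W * ε / 2 with hη
  set δ := W * ε / 4 with hδ
  set κ := Real.cos (Real.pi * δ)
  have hpi := Real.pi_pos
  have hκ0 : 0 < κ := Real.cos_pos_of_mem_Ioo ⟨by nlinarith, by nlinarith⟩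
  have hκ1 : κ < 1 := by
    rw [← Real.cos_zero]
    apply Real.cos_lt_cos_of_nonneg_of_le_pi le_rfl <;> nlinarith
  have hlog : Real.log κ < 0 := Real.log_neg hκ0 hκ1
  have hC₂ : 0 < -(η * Real.log κ) := by nlinarith
  set r := Real.exp (η * Real.log κ)
  have hr1 : r < 1 := by
    rw [Real.exp_lt_one_iff]
    linarith
  obtain ⟨N₁, hN₁⟩ := Filter.eventually_atTop.mp
    (eventually_pow_three_mul_pow_le (4 * (κ ^ 2)⁻¹) (Real.exp_pos _).le hr1)
  obtain ⟨N₂, hN₂⟩ := exists_nat_gt (1 / (W * ε))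
  refine ⟨-(η * Real.log κ), max N₁ N₂, one_pos, hC₂, fun N hN s lam h l hl => ?_⟩
  have hN1 : N₁ ≤ N := (le_max_left _ _).trans hN
  have hN2 : 1 < N * (W * ε) := by
    rw [← div_lt_iff₀ hWε]
    exact hN₂.trans_le (by exact_mod_cast (le_max_right _ _).trans hN)
  have hN0 : (0 : ℝ) ≤ N := Nat.cast_nonneg N
  set L := ⌊η * N⌋₊
  have hL1 : (L : ℝ) ≤ η * N := Nat.floor_le (by positivity)
  have hL2 : η * N < L + 1 := Nat.lt_floor_add_one _
  have hcard : (gridPoints (N + L) (W - δ) (1 - W + δ)).card < N - l := by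
    have h1 := card_gridPoints_le (N + L) (u := W - δ) (v := 1 - W + δ) (by linarith)
      (by linarith)
    push_cast at h1
    have h2 : (L : ℝ) * (1 - W + δ - (W - δ)) ≤ η * N := by nlinarith
    have h3 : ((gridPoints (N + L) (W - δ) (1 - W + δ)).card : ℝ) + (l : ℕ) < N := by
      rw [add_mul] at h1
      rw [hη, hδ] at *
      nlinarith
    have h4 : (gridPoints (N + L) (W - δ) (1 - W + δ)).card + (l : ℕ) < N := by
      exact_mod_cast h3
    omega
  have hmain := h.one_sub_lam_le hW2 l L (by positivity) (by linarith) hcard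
  have hM : ((N + L : ℕ) : ℝ) ≤ 2 * N := by
    push_cast
    nlinarith
  -- Here `r = κ ^ η`, and `(κ ^ 2)⁻¹` pays for the floor in `L`. One `r ^ N` will absorb the cubic
  -- prefactor for large `N`; the other is the final bound, which is why `C₁ = 1` suffices.
  have hpow : κ ^ (2 * L) ≤ (κ ^ 2)⁻¹ * (r ^ N * r ^ N) := by
    rw [le_inv_mul_iff₀ (by positivity), ← pow_add, ← Real.exp_nat_mul,
      ← Real.exp_add, ← Real.exp_log (pow_pos hκ0 _), Real.log_pow, Real.exp_le_exp]
    push_cast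
    nlinarith
  have hrN : Real.exp (-(-(η * Real.log κ)) * N) = r ^ N := by
    rw [← Real.exp_nat_mul]
    congr 1
    ring
  have hr0 : 0 < r ^ N := by positivity
  have : 1 - lam l ≤ r ^ N := by
    calc 1 - lam l ≤ ((N + L : ℕ) : ℝ) ^ 2 * N * κ ^ (2 * L) := hmain
      _ ≤ (2 * N) ^ 2 * N * ((κ ^ 2)⁻¹ * (r ^ N * r ^ N)) := by gcongr
      _ = 4 * (κ ^ 2)⁻¹ * ((N : ℝ) ^ 3 * r ^ N) * r ^ N := by ring
      _ ≤ 1 * r ^ N := by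
          gcongr
          exact hN₁ N hN1
      _ = r ^ N := one_mul _
  rw [hrN]
  linarith

end MultibandDPSS

theorem mainTheorem9 :
    -- the constants exist, with `C₁` absolute and `C₂`, `N₀` depending on `W` and `ε` only
    (∃ C₁ : ℝ, 0 < C₁ ∧ ∀ W ε : ℝ, 0 < W → W < 1 / 2 → 0 < ε → ε < 1 →
      ∃ (C₂ : ℝ) (N₀ : ℕ), MultibandDPSS.ClusterNearOne W ε C₁ C₂ N₀) ∧
    -- the coherence bound holds with all such constants
    (∀ (W ε C₁ C₂ : ℝ) (N₀ : ℕ), 0 < W → W < 1 / 2 → 0 < ε → ε < 1 →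
      MultibandDPSS.ClusterNearOne W ε C₁ C₂ N₀ →
      ∀ (Bnyq Bband Ts : ℝ) (J : ℕ), 0 < Bnyq → 0 < Bband → (J : ℝ) = Bnyq / Bband →
        0 < Ts → Ts ≤ 1 / Bnyq → W = Bband * Ts / 2 →
      ∀ (N k : ℕ) (hkN : k ≤ N), 1 ≤ N → N₀ ≤ N → (k : ℝ) ≤ 2 * N * W * (1 - ε) →
      ∀ (s : Fin N → ℤ → ℝ) (lam : Fin N → ℝ), MultibandDPSS.IsDPSS N W s lam →
        k * J < N ∧
        ∀ p q : Fin J × Fin k, p ≠ q →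
          ‖inner ℂ
              (WithLp.toLp 2 ((MultibandDPSS.dictionary s hkN J Bnyq Bband Ts).col p) :
                EuclideanSpace ℂ (Fin N))
              (WithLp.toLp 2 ((MultibandDPSS.dictionary s hkN J Bnyq Bband Ts).col q) :
                EuclideanSpace ℂ (Fin N))‖
            ≤ 3 * C₁ ^ (1 / 2 : ℝ) * Real.exp (-(C₂ * N / 2))) := by
  refine ⟨⟨1, one_pos, fun W ε hW hW2 hε hε1 =>
    MultibandDPSS.exists_clusterNearOne hW hW2 hε hε1⟩, ?_⟩
  intro W ε C₁ C₂ N₀ hW _ hε hε1 hcl Bnyq Bband Ts J hBn hBb hJ _ hTs1 hWB N k hkN hN hN₀ hk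
    s lam h
  have hJ1 : J * (Bband * Ts) ≤ 1 := by
    rw [hJ, ← mul_assoc, div_mul_cancel₀ _ hBb.ne']
    exact (le_div_iff₀' hBn).mp hTs1
  refine ⟨MultibandDPSS.card_dictionary_lt hN hε hε1 ?_ hk, fun p q hpq => ?_⟩
  · rwa [show 2 * W = Bband * Ts by linarith]
  · exact h.coherence_le hW hcl.1 (hcl.2.2 N hN₀ s lam h) hkN hk hJ1 hWB hpq
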